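/- Let $x=(x_1,x_2,\dots)$ be infinitely many variables and let $\Lambda_{\mathbb Q}=\mathbb Q[p_1,p_2,\dots]$ be the ring of symmetric functions in $x$ with rational coefficients, where $p_k=\sum_i x_i^k$. The shiftification of $f\in\Lambda_{\mathbb Q}$, denoted $f(x/x)$, is the image of $f$ under the $\mathbb Q$-algebra homomorphism $\Lambda_{\mathbb Q}\to\Lambda_{\mathbb Q}$ with $p_k\mapsto 2p_k$ for $k$ odd and $p_k\mapsto 0$ for $k$ even. A parking function of length $n$ is a sequence $(a_1,\dots,a_n)$ of positive integers whose increasing rearrangement $b_1\le\cdots\le b_n$ satisfies $b_i\le i$ for all $i$. Let $\mathrm{PF}_n\in\Lambda_{\mathbb Q}$ be the Frobenius characteristic of the action of the symmetric group $S_n$ on the set of parking functions of length $n$ by permuting coordinates, and let $\mathrm{sh}_n(x)=\mathrm{PF}_n(x/x)$. Let $$K(x,t)=\prod_{i\ge 1}\frac{1+x_it}{1-x_it}$$ as a formal power series in $t$ with coefficients in $\mathbb Q[[x_1,x_2,\dots]]$ (the product converges coefficientwise). **Lemma.** The coefficient of $t$ in $tK(x,-t)$ is invertible, so that $tK(x,-t)$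 has a compositional inverse with respect to $t$, and $$\sum_{n\ge 0}\mathrm{sh}_n(x)\,t^{n+1}=\bigl(tK(x,-t)\bigr)^{\langle -1\rangle},$$ where $\langle -1\rangle$ denotes the compositional inverse with respect to $t$. -/

import Mathlib

open scoped MvPowerSeries.WithPiTopology PowerSeries.WithPiTopology

noncomputable section
namespace ShiftedParking
open Finsupp

theorem rename_eq_self_iff (σ : Equiv.Perm ℕ) (f : MvPowerSeries ℕ ℚ) :
    MvPowerSeries.rename σ f = f ↔
      ∀ m : ℕ →₀ ℕ, f.coeff (embDomain σ.toEmbedding m) = f.coeff m := by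
  have key : ∀ m : ℕ →₀ ℕ, (MvPowerSeries.rename σ f).coeff (embDomain σ.toEmbedding m)
      = f.coeff m := fun m => MvPowerSeries.coeff_embDomain_rename σ.toEmbedding f m
  constructor
  · intro h m
    rw [← key m, h]
  · intro h
    ext m
    obtain ⟨m', rfl⟩ : ∃ m', m = embDomain σ.toEmbedding m' :=
      ⟨embDomain σ.symm.toEmbedding m, by
        simp [embDomain_eq_mapDomain, ← Finsupp.mapDomain_comp]⟩
    rw [key, h]

/-- The ring `Λ_ℚ` of symmetric functions in the variables `x₁, x₂, …` (here `X 0, X 1, …`):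
formal power series over `ℚ` of bounded degree, invariant under all permutations of the variables. -/
def SymFun : Subalgebra ℚ (MvPowerSeries ℕ ℚ) where
  carrier := {f | (∃ d : ℕ, ∀ m : ℕ →₀ ℕ, d < m.degree → f.coeff m = 0) ∧
    ∀ σ : Equiv.Perm ℕ, MvPowerSeries.rename σ f = f}
  mul_mem' := by
    rintro f g ⟨⟨d, hd⟩, hf⟩ ⟨⟨e, he⟩, hg⟩
    refine ⟨⟨d + e, fun m hm => ?_⟩, fun σ => by rw [map_mul, hf, hg]⟩
    rw [MvPowerSeries.coeff_mul]
    refine Finset.sum_eq_zero fun p hp => ?_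
    have h : p.1.degree + p.2.degree = m.degree := by
      rw [← map_add, Finset.HasAntidiagonal.mem_antidiagonal.mp hp]
    by_cases h1 : d < p.1.degree
    · rw [hd _ h1, zero_mul]
    · rw [he _ (by omega), mul_zero]
  add_mem' := by
    rintro f g ⟨⟨d, hd⟩, hf⟩ ⟨⟨e, he⟩, hg⟩
    refine ⟨⟨max d e, fun m hm => ?_⟩, fun σ => by rw [map_add, hf, hg]⟩
    rw [map_add, hd m (lt_of_le_of_lt (le_max_left _ _) hm),
      he m (lt_of_le_of_lt (le_max_right _ _) hm), add_zero]
  algebraMap_mem' r := by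
    refine ⟨⟨0, fun m hm => ?_⟩, fun σ => AlgHom.commutes _ r⟩
    have : m ≠ 0 := by rintro rfl; simp at hm
    simp [MvPowerSeries.algebraMap_apply, MvPowerSeries.coeff_C, this]

open Classical in
/-- The power sum symmetric function `p_k = ∑ᵢ xᵢ ^ k`, for `k ≥ 1`, given by its coefficients. -/
def powerSum (k : ℕ) : SymFun where
  val := fun m => if ∃ i : ℕ, m = single i k then 1 else 0
  property := by
    refine ⟨⟨k, fun m hm => if_neg ?_⟩, fun σ => (rename_eq_self_iff σ _).2 fun m => ?_⟩
    · rintro ⟨i, rfl⟩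
      simp at hm
    · refine if_congr ⟨?_, ?_⟩ rfl rfl
      · rintro ⟨i, hi⟩
        refine ⟨σ.symm i, embDomain_injective σ.toEmbedding ?_⟩
        simp [hi, embDomain_single]
      · rintro ⟨i, rfl⟩
        exact ⟨σ i, by simp [embDomain_single]⟩

theorem esymm_mem_range (N : ℕ) (k : ℕ) (hk : k ≤ N) :
    MvPolynomial.esymm (Fin N) ℚ k ∈
      (MvPolynomial.aeval (R := ℚ) fun i : Fin N => MvPolynomial.psum (Fin N) ℚ (i + 1)).range := by
  induction k using Nat.strong_induction_on with
  | _ k ih =>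
    rcases Nat.eq_zero_or_pos k with rfl | hpos
    · rw [MvPolynomial.esymm_zero]; exact one_mem _
    have h := MvPolynomial.mul_esymm_eq_sum (Fin N) ℚ k
    have h2 : MvPolynomial.esymm (Fin N) ℚ k = (k : ℚ)⁻¹ • ((-1) ^ (k + 1) *
        ∑ a ∈ Finset.HasAntidiagonal.antidiagonal k with a.1 < k, (-1) ^ a.1 *
          MvPolynomial.esymm (Fin N) ℚ a.1 * MvPolynomial.psum (Fin N) ℚ a.2) := by
      rw [← h, ← nsmul_eq_mul, ← Nat.cast_smul_eq_nsmul ℚ, smul_smul, inv_mul_cancel₀, one_smul]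
      exact_mod_cast hpos.ne'
    rw [h2]
    refine Subalgebra.smul_mem _ (mul_mem (pow_mem (neg_mem (one_mem _)) _)
      (sum_mem fun a ha => ?_)) _
    rw [Finset.mem_filter, Finset.HasAntidiagonal.mem_antidiagonal] at ha
    refine mul_mem (mul_mem (pow_mem (neg_mem (one_mem _)) _) (ih _ ha.2 (by omega))) ?_
    refine ⟨MvPolynomial.X ⟨a.2 - 1, by omega⟩, ?_⟩
    have : a.2 - 1 + 1 = a.2 := by omega
    simp [this]

theorem exists_aeval_psum (N : ℕ) (q : MvPolynomial (Fin N) ℚ) (hq : q.IsSymmetric) :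
    ∃ P : MvPolynomial (Fin N) ℚ,
      MvPolynomial.aeval (fun i : Fin N => MvPolynomial.psum (Fin N) ℚ (i + 1)) P = q := by
  obtain ⟨R, hR⟩ := MvPolynomial.esymmAlgHom_surjective (σ := Fin N) ℚ (n := N) (by simp) ⟨q, hq⟩
  have h : q = MvPolynomial.aeval (fun i : Fin N => MvPolynomial.esymm (Fin N) ℚ (i + 1)) R := by
    rw [← MvPolynomial.esymmAlgHom_apply, hR]
  rw [← AlgHom.mem_range, h]
  have : (MvPolynomial.aeval (R := ℚ) fun i : Fin N => MvPolynomial.esymm (Fin N) ℚ (i + 1)).range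
      ≤ (MvPolynomial.aeval (R := ℚ) fun i : Fin N =>
          MvPolynomial.psum (Fin N) ℚ (i + 1)).range := by
    rw [← Algebra.adjoin_range_eq_range_aeval, Algebra.adjoin_le_iff]
    rintro _ ⟨i, rfl⟩
    exact esymm_mem_range N _ i.2
  exact this ⟨R, rfl⟩

theorem injective_of_surjective_endo {A : Type*} [CommRing A] [IsNoetherianRing A] (f : A →+* A)
    (hf : Function.Surjective f) : Function.Injective f := by
  have hmono : Monotone fun n : ℕ => RingHom.ker (f ^ n) := monotone_nat_of_le_succ fun n x hx => by
    rw [RingHom.mem_ker] at hx ⊢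
    rw [pow_succ', RingHom.coe_mul, Function.comp_apply, hx, map_zero]
  obtain ⟨n, hn⟩ := monotone_stabilizes_iff_noetherian.mpr ‹IsNoetherianRing A› ⟨_, hmono⟩
  rw [injective_iff_map_eq_zero]
  intro a ha
  have hs : Function.Surjective (f ^ n) := by
    rw [RingHom.coe_pow]; exact hf.iterate n
  obtain ⟨b, rfl⟩ := hs a
  have hb : b ∈ RingHom.ker (f ^ (n + 1)) := by
    rw [RingHom.mem_ker, pow_succ', RingHom.coe_mul, Function.comp_apply, ha]
  have hnn : RingHom.ker (f ^ n) = RingHom.ker (f ^ (n + 1)) := hn (n + 1) n.le_succ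
  rw [← hnn] at hb
  exact hb

theorem aeval_psum_injective (N : ℕ) : Function.Injective
    (MvPolynomial.aeval (R := ℚ) fun i : Fin N => MvPolynomial.psum (Fin N) ℚ (i + 1)) := by
  let φ : MvPolynomial (Fin N) ℚ →ₐ[ℚ] MvPolynomial.symmetricSubalgebra (Fin N) ℚ :=
    MvPolynomial.aeval fun i : Fin N =>
      ⟨MvPolynomial.psum (Fin N) ℚ (i + 1), MvPolynomial.psum_isSymmetric _ _ _⟩
  have hval : ∀ P, ((φ P : MvPolynomial.symmetricSubalgebra (Fin N) ℚ) : MvPolynomial (Fin N) ℚ) =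
      MvPolynomial.aeval (fun i : Fin N => MvPolynomial.psum (Fin N) ℚ (i + 1)) P := fun P => by
    have : (MvPolynomial.symmetricSubalgebra (Fin N) ℚ).val.comp φ =
        MvPolynomial.aeval (fun i : Fin N => MvPolynomial.psum (Fin N) ℚ (i + 1)) := by
      ext i; simp [φ]
    exact DFunLike.congr_fun this P
  have hsurj : Function.Surjective φ := fun q => by
    obtain ⟨P, hP⟩ := exists_aeval_psum N q.1 q.2
    exact ⟨P, Subtype.ext ((hval P).trans hP)⟩
  let e := (MvPolynomial.esymmAlgEquiv (R := ℚ) (Fin N) (n := N) (by simp)).symm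
  have hinj := injective_of_surjective_endo (e.toAlgHom.comp φ : _ →+* MvPolynomial (Fin N) ℚ)
    (e.surjective.comp hsurj)
  intro P Q hPQ
  have : φ P = φ Q := Subtype.ext (by rw [hval, hval, hPQ])
  exact hinj (by simp [this])

/-- Setting all but the first `N` variables equal to zero. -/
def restrict (N : ℕ) : MvPowerSeries ℕ ℚ →ₐ[ℚ] MvPowerSeries (Fin N) ℚ :=
  MvPowerSeries.killCompl Fin.valEmbedding

theorem restrict_powerSum (N k : ℕ) (hk : 0 < k) :
    restrict N (powerSum k) = (MvPolynomial.psum (Fin N) ℚ k : MvPowerSeries (Fin N) ℚ) := by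
  classical
  ext m
  rw [restrict, MvPowerSeries.coeff_killCompl, MvPolynomial.coeff_coe, MvPolynomial.psum,
    MvPolynomial.coeff_sum]
  simp only [MvPolynomial.coeff_X_pow]
  change (if _ then (1 : ℚ) else 0) = _
  split_ifs with h
  · obtain ⟨i, hi⟩ := h
    have hiN : i ∈ Set.range (Fin.valEmbedding (n := N)) := by
      by_contra hc
      have h1 := embDomain_of_notMem_range (Fin.valEmbedding (n := N)) m i hc
      rw [hi, single_eq_same] at h1
      omega
    obtain ⟨j, rfl⟩ := hiN
    have hm : m = single j k := by
      apply embDomain_injective Fin.valEmbedding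
      rw [hi, embDomain_single]
    subst hm
    rw [Finset.sum_eq_single j]
    · simp
    · intro b _ hb
      rw [if_neg]
      intro hc
      exact hb (Finsupp.single_left_injective hk.ne' hc)
    · simp
  · rw [Finset.sum_eq_zero]
    intro j _
    rw [if_neg]
    rintro rfl
    exact h ⟨j, by simp [embDomain_single]⟩

theorem restrict_aeval (N : ℕ) (P : MvPolynomial (Fin N) ℚ) :
    restrict N (MvPolynomial.aeval (R := ℚ) (fun i : Fin N => powerSum (i + 1)) P : SymFun) =
      (MvPolynomial.aeval (fun i : Fin N => MvPolynomial.psum (Fin N) ℚ (i + 1)) P :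
        MvPolynomial (Fin N) ℚ) := by
  have : ((restrict N).comp SymFun.val).comp
      (MvPolynomial.aeval (R := ℚ) (fun i : Fin N => powerSum (i + 1))) =
      (MvPolynomial.coeToMvPowerSeries.algHom (R := ℚ) ℚ).comp
        (MvPolynomial.aeval (fun i : Fin N => MvPolynomial.psum (Fin N) ℚ (i + 1))) := by
    ext1 i
    simpa [MvPolynomial.coeToMvPowerSeries.algHom_apply] using restrict_powerSum N (i + 1) (by omega)
  simpa [MvPolynomial.coeToMvPowerSeries.algHom_apply] using DFunLike.congr_fun this P

theorem eq_zero_of_restrict (d : ℕ) (f : SymFun)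
    (hd : ∀ m : ℕ →₀ ℕ, d < m.degree → f.1.coeff m = 0) (hf : restrict d f = 0) : f = 0 := by
  apply Subtype.ext
  ext m
  by_cases hm : d < m.degree
  · exact hd m hm
  have hcard : m.support.card ≤ d := by
    have : m.support.card ≤ m.degree := by
      rw [Finsupp.degree, Finset.card_eq_sum_ones]
      exact Finset.sum_le_sum fun i hi => Nat.one_le_iff_ne_zero.mpr (mem_support_iff.mp hi)
    omega
  obtain ⟨t, ht, htc⟩ := Finset.exists_subset_card_eq (s := Finset.range d) (n := m.support.card)
    (by simpa using hcard)
  obtain ⟨σ, hσ⟩ : ∃ σ : Equiv.Perm ℕ, ∀ i ∈ m.support, σ i ∈ t := by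
    let e : {x // x ∈ m.support} ≃ {x // x ∈ t} := Finset.equivOfCardEq htc.symm
    refine ⟨e.extendSubtype, fun i hi => e.extendSubtype_mem i hi⟩
  have hs := (rename_eq_self_iff σ f.1).1 (f.2.2 σ) m
  rw [← hs]
  set m' := embDomain σ.toEmbedding m with hm'
  have hsupp : ∀ i ∈ m'.support, i < d := by
    intro i hi
    rw [hm', support_embDomain, Finset.mem_map] at hi
    obtain ⟨j, hj, rfl⟩ := hi
    exact Finset.mem_range.mp (ht (hσ j hj))
  obtain ⟨x, hx⟩ : ∃ x : Fin d →₀ ℕ, embDomain Fin.valEmbedding x = m' := by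
    refine ⟨m'.comapDomain Fin.valEmbedding Fin.valEmbedding.injective.injOn, ?_⟩
    apply embDomain_comapDomain
    intro i hi
    exact ⟨⟨i, hsupp i hi⟩, rfl⟩
  have := congrArg (MvPowerSeries.coeff x) hf
  rw [restrict, MvPowerSeries.coeff_killCompl, hx] at this
  simpa using this

theorem exists_trunc (N d : ℕ) (P : MvPolynomial (Fin N) ℚ) : ∃ Q : MvPolynomial (Fin N) ℚ,
    ∀ m : ℕ →₀ ℕ,
    (MvPolynomial.aeval (R := ℚ) (fun i : Fin N => powerSum (i + 1)) Q : SymFun).1.coeff m =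
    if d < m.degree then 0 else
      (MvPolynomial.aeval (R := ℚ) (fun i : Fin N => powerSum (i + 1)) P : SymFun).1.coeff m := by
  induction P using MvPolynomial.induction_on' with
  | monomial u a =>
    obtain ⟨w, hw⟩ : ∃ w : ℕ, MvPowerSeries.IsHomogeneous
        (MvPolynomial.aeval (R := ℚ) (fun i : Fin N => powerSum (i + 1))
          (MvPolynomial.monomial u a) : SymFun).1 w := by
      refine MvPolynomial.induction_on_monomial
        (motive := fun p => ∃ w : ℕ, MvPowerSeries.IsHomogeneous
          (MvPolynomial.aeval (R := ℚ) (fun i : Fin N => powerSum (i + 1)) p : SymFun).1 w)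
        (fun c => ⟨0, fun {m} hm => ?_⟩) (fun p i hp => ?_) u a
      · by_contra h0
        refine hm ?_
        have : m ≠ 0 := by rintro rfl; simp at h0
        simp [MvPowerSeries.algebraMap_apply, MvPowerSeries.coeff_C, this]
      · obtain ⟨w, hw⟩ := hp
        refine ⟨w + (i + 1), ?_⟩
        rw [map_mul, MvPolynomial.aeval_X]
        refine MvPowerSeries.IsHomogeneous.mul hw fun {m} hm => ?_
        by_contra h0
        refine hm (if_neg ?_)
        rintro ⟨j, rfl⟩
        exact h0 (by simp [Finsupp.weight_single])
    by_cases hwd : d < w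
    · refine ⟨0, fun m => ?_⟩
      rw [map_zero]
      split_ifs with hm
      · rfl
      · rw [hw.coeff_eq_zero (by omega)]; rfl
    · refine ⟨MvPolynomial.monomial u a, fun m => ?_⟩
      split_ifs with hm
      · rw [hw.coeff_eq_zero (by omega)]
      · rfl
  | add P P' h h' =>
    obtain ⟨Q, hQ⟩ := h
    obtain ⟨Q', hQ'⟩ := h'
    refine ⟨Q + Q', fun m => ?_⟩
    rw [map_add, map_add, Subalgebra.coe_add, Subalgebra.coe_add, map_add, map_add, hQ, hQ']
    split_ifs <;> simp

/-- The power sums `p₁, p₂, …` freely generate `Λ_ℚ` as a `ℚ`-algebra. -/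
theorem powerSum_bijective : Function.Bijective
    (MvPolynomial.aeval (R := ℚ) fun k : ℕ+ => powerSum k) := by
  constructor
  · rw [injective_iff_map_eq_zero]
    intro P hP
    obtain ⟨n, g, -, q, rfl⟩ := MvPolynomial.exists_fin_rename P
    obtain ⟨N, hN⟩ : ∃ N : ℕ, ∀ i, (g i : ℕ) ≤ N :=
      ⟨Finset.univ.sup fun i => (g i : ℕ), fun i =>
        Finset.le_sup (f := fun i => (g i : ℕ)) (Finset.mem_univ i)⟩
    let g' : Fin n → Fin N := fun i => ⟨g i - 1, by have := hN i; have := (g i).pos; omega⟩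
    have hg : g = (fun j : Fin N => j.1.succPNat) ∘ g' := by
      funext i
      apply PNat.coe_injective
      have := (g i).pos
      simp only [Function.comp_apply, g', Nat.succPNat_coe, Nat.succ_eq_add_one]
      omega
    rw [hg, ← MvPolynomial.rename_rename] at hP ⊢
    rw [MvPolynomial.aeval_rename] at hP
    have h := restrict_aeval N (MvPolynomial.rename g' q)
    have hz : MvPolynomial.rename g' q = 0 := by
      apply aeval_psum_injective N
      rw [map_zero]
      apply MvPolynomial.coe_injective
      rw [← h, MvPolynomial.coe_zero]
      change restrict N (MvPolynomial.aeval (R := ℚ) (fun i : Fin N => powerSum (i + 1)) _ :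
        SymFun).1 = 0
      erw [hP]
      exact map_zero _
    rw [hz, map_zero]
  · intro f
    obtain ⟨d, hd⟩ := f.2.1
    have hdr : ∀ m : Fin d →₀ ℕ, d < m.degree → (restrict d f.1).coeff m = 0 := fun m hm => by
      rw [restrict, MvPowerSeries.coeff_killCompl]
      exact hd _ (by rwa [embDomain_eq_mapDomain, degree_mapDomain])
    set q : MvPolynomial (Fin d) ℚ := MvPowerSeries.truncTotal (d + 1) (restrict d f.1) with hq
    have hqf : (q : MvPowerSeries (Fin d) ℚ) = restrict d f.1 := by
      ext m
      rw [MvPolynomial.coeff_coe, hq, MvPowerSeries.coeff_truncTotal_eq_ite]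
      split_ifs with h
      · rfl
      · exact (hdr m (by omega)).symm
    have hqs : q.IsSymmetric := by
      intro e
      apply MvPolynomial.coe_injective
      rw [← MvPowerSeries.rename_coe, hqf]
      ext m
      obtain ⟨m', rfl⟩ : ∃ m', m = embDomain e.toEmbedding m' :=
        ⟨embDomain e.symm.toEmbedding m, by
          simp [embDomain_eq_mapDomain, ← Finsupp.mapDomain_comp]⟩
      refine (MvPowerSeries.coeff_embDomain_rename e.toEmbedding _ m').trans ?_
      rw [restrict, MvPowerSeries.coeff_killCompl, MvPowerSeries.coeff_killCompl]
      obtain ⟨σ, hσ⟩ : ∃ σ : Equiv.Perm ℕ, ∀ i : Fin d, σ i = e i :=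
        ⟨e.viaFintypeEmbedding Fin.valEmbedding,
          fun i => e.viaFintypeEmbedding_apply_image Fin.valEmbedding i⟩
      have hs := (rename_eq_self_iff σ f.1).1 (f.2.2 σ) (embDomain Fin.valEmbedding m')
      rw [← hs]
      congr 1
      simp only [embDomain_eq_mapDomain, ← Finsupp.mapDomain_comp]
      have : (σ.toEmbedding : ℕ → ℕ) ∘ (Fin.valEmbedding : Fin d → ℕ) =
          (Fin.valEmbedding : Fin d → ℕ) ∘ (e.toEmbedding : Fin d → Fin d) := funext hσ
      rw [this]
    obtain ⟨P, hP⟩ := exists_aeval_psum d q hqs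
    obtain ⟨Q, hQ⟩ := exists_trunc d d P
    refine ⟨MvPolynomial.rename (fun j : Fin d => j.1.succPNat) Q, ?_⟩
    rw [MvPolynomial.aeval_rename]
    change MvPolynomial.aeval (R := ℚ) (fun i : Fin d => powerSum (i + 1)) Q = f
    rw [← sub_eq_zero]
    apply eq_zero_of_restrict d
    · intro m hm
      rw [Subalgebra.coe_sub, map_sub, hQ, if_pos hm, hd m hm, sub_zero]
    · ext m
      rw [Subalgebra.coe_sub, map_sub, map_sub, restrict, MvPowerSeries.coeff_killCompl, hQ]
      split_ifs with hm
      · rw [MvPowerSeries.coeff_killCompl, hd _ hm]; simp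
      · rw [← MvPowerSeries.coeff_killCompl (e := Fin.valEmbedding)]
        have := restrict_aeval d P
        rw [restrict] at this
        rw [this, hP, hqf, restrict, sub_self, map_zero]

/-- The identification `Λ_ℚ = ℚ[p₁, p₂, …]`. -/
def powerSumEquiv : MvPolynomial ℕ+ ℚ ≃ₐ[ℚ] SymFun :=
  AlgEquiv.ofBijective (MvPolynomial.aeval fun k : ℕ+ => powerSum k) powerSum_bijective

/-- The shiftification `f ↦ f(x/x)`: regarding `f` as a polynomial in the power sums, substitute
`p_k → 2 p_k` for odd `k` and `p_k → 0` for even `k`. -/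
def shiftification : SymFun →ₐ[ℚ] SymFun :=
  (MvPolynomial.aeval fun k : ℕ+ => if Odd (k : ℕ) then 2 * powerSum k else 0).comp
    powerSumEquiv.symm.toAlgHom

theorem shiftification_powerSum (k : ℕ) (hk : 0 < k) :
    shiftification (powerSum k) = if Odd k then 2 * powerSum k else 0 := by
  have h : powerSumEquiv.symm (powerSum k) = MvPolynomial.X ⟨k, hk⟩ := by
    rw [AlgEquiv.symm_apply_eq]
    exact (MvPolynomial.aeval_X (R := ℚ) (fun k : ℕ+ => powerSum k) ⟨k, hk⟩).symm
  change MvPolynomial.aeval _ (powerSumEquiv.symm (powerSum k)) = _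
  rw [h]
  exact MvPolynomial.aeval_X _ _

/-- The power sum `p_μ = p_{μ₁} p_{μ₂} ⋯` of a partition `μ`. -/
def powerSumPart {n : ℕ} (μ : n.Partition) : SymFun := (μ.parts.map powerSum).prod

/-- The Frobenius characteristic `(1 / n!) ∑_{w ∈ S_n} χ(w) p_{ρ(w)}` of a representation of `S_n`
with character `χ`, where `ρ(w)` is the cycle type of `w` (fixed points included). -/
def frobeniusCharacteristic {n : ℕ} {V : Type*} [AddCommGroup V] [Module ℚ V]
    [FiniteDimensional ℚ V] (ρ : Representation ℚ (Equiv.Perm (Fin n)) V) : SymFun :=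
  (n.factorial : ℚ)⁻¹ • ∑ w : Equiv.Perm (Fin n), ρ.character w • powerSumPart w.partition

/-- A sequence `a` of `n` positive integers is a parking function if its increasing rearrangement
`b₁ ≤ ⋯ ≤ b_n` satisfies `bᵢ ≤ i`. Positions are numbered from `0` here. -/
def IsParkingFunction {n : ℕ} (a : Fin n → ℕ) : Prop :=
  (∀ i, 1 ≤ a i) ∧ ∀ i : Fin n, a (Tuple.sort a i) ≤ i + 1

/-- The set of parking functions of length `n`. -/
def ParkingFunction (n : ℕ) : Type := {a : Fin n → ℕ // IsParkingFunction a}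

instance (n : ℕ) : Finite (ParkingFunction n) := by
  refine Finite.of_injective (β := Fin n → Fin (n + 1))
    (fun a i => ⟨a.1 i, ?_⟩) fun a b h => Subtype.ext (funext fun i => ?_)
  · have := a.2.2 ((Tuple.sort a.1).symm i)
    rw [Equiv.apply_symm_apply] at this
    omega
  · exact congrArg Fin.val (congrFun h i)

/-- The symmetric group permutes the coordinates of parking functions. -/
instance (n : ℕ) : MulAction (Equiv.Perm (Fin n)) (ParkingFunction n) where
  smul w a := ⟨fun i => a.1 (w⁻¹ i), fun i => a.2.1 _, fun i => by
    have h := congrFun (Tuple.comp_perm_comp_sort_eq_comp_sort (f := a.1) (σ := w⁻¹)) i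
    exact (le_of_eq h).trans (a.2.2 i)⟩
  one_smul _ := rfl
  mul_smul v w a := Subtype.ext (funext fun i => by
    change a.1 ((v * w)⁻¹ i) = a.1 (w⁻¹ (v⁻¹ i))
    rw [mul_inv_rev, Equiv.Perm.mul_apply])

/-- The parking function symmetric function `PF_n`: the Frobenius characteristic of the permutation
representation of `S_n` on the parking functions of length `n`. -/
def parkingSymFun (n : ℕ) : SymFun :=
  frobeniusCharacteristic
    (Representation.ofMulAction ℚ (Equiv.Perm (Fin n)) (ParkingFunction n))

/-- The symmetric function `sh_n = PF_n(x/x)`. -/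
def shiftedParkingSymFun (n : ℕ) : SymFun := shiftification (parkingSymFun n)

/-- The factor `(1 + xᵢ t) / (1 - xᵢ t)`, a power series in `t` over power series in `x`. -/
def kFactor (i : ℕ) : PowerSeries (MvPowerSeries ℕ ℚ) :=
  (1 + PowerSeries.C (MvPowerSeries.X i) * PowerSeries.X) *
    PowerSeries.invOfUnit (1 - PowerSeries.C (MvPowerSeries.X i) * PowerSeries.X) 1

/-- The series `K(x, t) = ∏ᵢ (1 + xᵢ t) / (1 - xᵢ t)`. The product is taken for coefficientwise
convergence; every coefficient of the partial products is eventually constant. -/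
def kSeries : PowerSeries (MvPowerSeries ℕ ℚ) := ∏' i : ℕ, kFactor i

end ShiftedParking
end

/-! Write `q_k` for the shiftification of `p_k`: `2 p_k` for odd `k`, `0` for even `k`. Since `t
K'/K = ∑ q_k t^k` has only odd terms, `K(x,-t) = 1/K(x,t)`. The claim therefore concerns the inverse
of `t/K`, and Lagrange inversion reduces it to `(n+1) sh_n = [tⁿ] K^(n+1)`.

Both sides equal `(1/n!) ∑_w ∏_c (n+1) q_{|c|}`, with `c` running over the cycles of `w ∈ S_n`. For
the right side, `K^(n+1)` has logarithmic derivative `∑ (n+1) q_k t^(k-1)`, and the resulting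
recursion for its coefficients is the one satisfied by cycle indices (`mul_cycleIndex`). For the
left side, Pollak's circle argument (`circularShift_bijective`) pairs parking functions and
rotations with arbitrary maps `Fin n → ZMod (n+1)`, compatibly with `S_n`. Hence `n+1` times the
number of parking functions fixed by `w` is `(n+1)^c(w)`, where `c(w)` is the number of cycles. -/

noncomputable section
namespace ShiftedParking

/-! ### Logarithmic derivatives and Lagrange inversion -/

section LogDerivative
open PowerSeries

variable {R : Type*} [CommRing R]

theorem coeff_X_mul_derivative (f : R⟦X⟧) (n : ℕ) :
    coeff n (X * d⁄dX R f) = n * coeff n f := by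
  cases n with
  | zero => simp
  | succ n => rw [coeff_succ_X_mul, coeff_derivative, mul_comm]; push_cast; rfl

theorem coeff_of_logDerivative {f Q : R⟦X⟧} (h : X * d⁄dX R f = Q * f) (n : ℕ) :
    n * coeff n f = ∑ p ∈ Finset.HasAntidiagonal.antidiagonal n, coeff p.1 Q * coeff p.2 f := by
  rw [← coeff_X_mul_derivative, h, coeff_mul]

/-- A logarithmic derivative determines the coefficients up to the constant term. -/
theorem coeff_eq_of_logDerivative [Algebra ℚ R] {Q : R⟦X⟧} (hQ : constantCoeff Q = 0)
    {a b : ℕ → R} (h0 : a 0 = b 0)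
    (ha : ∀ n : ℕ, n * a n =
      ∑ p ∈ Finset.HasAntidiagonal.antidiagonal n, coeff p.1 Q * a p.2)
    (hb : ∀ n : ℕ, n * b n =
      ∑ p ∈ Finset.HasAntidiagonal.antidiagonal n, coeff p.1 Q * b p.2) (n : ℕ) : a n = b n := by
  induction n using Nat.strong_induction_on with
  | _ n ih =>
    rcases Nat.eq_zero_or_pos n with rfl | hn
    · exact h0
    have h : (n : R) * a n = n * b n := by
      rw [ha, hb]
      refine Finset.sum_congr rfl fun p hp => ?_
      rw [Finset.HasAntidiagonal.mem_antidiagonal] at hp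
      rcases Nat.eq_zero_or_pos p.1 with h1 | h1
      · rw [h1, coeff_zero_eq_constantCoeff_apply, hQ, zero_mul, zero_mul]
      · rw [ih p.2 (by omega)]
    have hu : (algebraMap ℚ R (n : ℚ)⁻¹) * (n : R) = 1 := by
      rw [← map_natCast (algebraMap ℚ R) n, ← map_mul, inv_mul_cancel₀, map_one]
      exact_mod_cast hn.ne'
    rw [← one_mul (a n), ← one_mul (b n), ← hu, mul_assoc, h, mul_assoc]

theorem eq_of_logDerivative [Algebra ℚ R] {f g Q : R⟦X⟧} (hQ : constantCoeff Q = 0)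
    (h0 : constantCoeff f = constantCoeff g) (hf : X * d⁄dX R f = Q * f)
    (hg : X * d⁄dX R g = Q * g) : f = g := by
  ext n
  exact coeff_eq_of_logDerivative (a := fun n => coeff n f) (b := fun n => coeff n g) hQ
    (by simpa using h0) (coeff_of_logDerivative hf) (coeff_of_logDerivative hg) n

theorem logDerivative_mul {f g P Q : R⟦X⟧} (hf : X * d⁄dX R f = P * f)
    (hg : X * d⁄dX R g = Q * g) : X * d⁄dX R (f * g) = (P + Q) * (f * g) := by
  rw [Derivation.leibniz, smul_eq_mul, smul_eq_mul]
  linear_combination g * hf + f * hg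

theorem logDerivative_pow {f Q : R⟦X⟧} (hf : X * d⁄dX R f = Q * f) (m : ℕ) :
    X * d⁄dX R (f ^ m) = ((m : R⟦X⟧) * Q) * f ^ m := by
  induction m with
  | zero => simp
  | succ m ih =>
    rw [pow_succ, logDerivative_mul ih hf]
    push_cast
    ring

theorem logDerivative_prod {ι : Type*} (s : Finset ι) {f Q : ι → R⟦X⟧}
    (hf : ∀ i, X * d⁄dX R (f i) = Q i * f i) :
    X * d⁄dX R (∏ i ∈ s, f i) = (∑ i ∈ s, Q i) * ∏ i ∈ s, f i := by
  classical
  induction s using Finset.induction_on with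
  | empty => simp
  | insert i s hi ih =>
    rw [Finset.prod_insert hi, Finset.sum_insert hi]
    exact logDerivative_mul (hf i) ih

theorem logDerivative_rescale_neg_one {f Q : R⟦X⟧} (hf : X * d⁄dX R f = Q * f) :
    X * d⁄dX R (rescale (-1) f) = rescale (-1) Q * rescale (-1) f := by
  rw [← map_mul, ← hf]
  ext n
  rw [coeff_X_mul_derivative, coeff_rescale, coeff_rescale, coeff_X_mul_derivative]
  ring

/-- `G ^ k` is divisible by `X ^ k`, so only `k ≤ n` can contribute and the substitution becomes a
finite sum. -/
theorem coeff_subst_mul (F G : R⟦X⟧)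
    (hG : constantCoeff G = 0) (U : R⟦X⟧) (n : ℕ) :
    coeff n (F.subst G * U) =
      ∑ k ∈ Finset.range (n + 1), coeff k F * coeff n (G ^ k * U) := by
  have hs : HasSubst G := HasSubst.of_constantCoeff_zero' hG
  have key : ∀ i ≤ n, coeff i (F.subst G) =
      ∑ k ∈ Finset.range (n + 1), coeff k F * coeff i (G ^ k) := by
    intro i hi
    rw [coeff_subst' hs]
    simp only [smul_eq_mul]
    refine finsum_eq_sum_of_support_subset _ fun k hk => ?_
    rw [Finset.coe_range, Set.mem_Iio]
    by_contra hlt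
    refine hk ?_
    have : coeff i (G ^ k) = 0 := by
      obtain ⟨W, rfl⟩ := X_dvd_iff.mpr hG
      rw [mul_pow, coeff_X_pow_mul', if_neg (by omega)]
    simp only [this, mul_zero]
  simp only [coeff_mul, Finset.mul_sum]
  rw [Finset.sum_comm]
  refine Finset.sum_congr rfl fun p hp => ?_
  rw [Finset.HasAntidiagonal.mem_antidiagonal] at hp
  rw [key p.1 (by omega), Finset.sum_mul]
  exact Finset.sum_congr rfl fun k _ => mul_assoc _ _ _

/-- Lagrange inversion: if `F` is a left compositional inverse of `X / K`, then
`n [Xⁿ] F = [Xⁿ⁻¹] Kⁿ`. -/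
theorem lagrange_inversion [Algebra ℚ R] {K L F : R⟦X⟧} (hKL : K * L = 1)
    (hF : F.subst (X * L) = X) (n : ℕ) :
    (n + 1 : R) * coeff (n + 1) F = coeff n (K ^ (n + 1)) := by
  have hG : constantCoeff (X * L) = 0 := by simp
  have h1 := congrArg (d⁄dX R) hF
  rw [derivative_subst (HasSubst.of_constantCoeff_zero' hG), derivative_X] at h1
  have hL : d⁄dX R K * L + K * d⁄dX R L = 0 := by
    have := congrArg (d⁄dX R) hKL
    rw [Derivation.leibniz, derivative_one, smul_eq_mul, smul_eq_mul] at this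
    linear_combination this
  have h2 : K ^ (n + 1) = (d⁄dX R F).subst (X * L) * (d⁄dX R (X * L) * K ^ (n + 1)) := by
    rw [← mul_assoc, h1, one_mul]
  -- The quotient rule for `G = X / K`, with denominators cleared.
  have hGK : d⁄dX R (X * L) * K ^ 2 = K - X * d⁄dX R K := by
    rw [Derivation.leibniz, derivative_X, smul_eq_mul, smul_eq_mul]
    linear_combination (K + X * d⁄dX R K * (-1)) * hKL + X * K * hL
  -- Expand `F'(G) G' K^(n+1)` in powers of `G`; only the term `k = n` survives.
  rw [h2, coeff_subst_mul _ _ hG, Finset.sum_eq_single n]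
  · have h3 : (X * L) ^ n * (d⁄dX R (X * L) * K ^ (n + 1)) =
        X ^ n * (d⁄dX R (X * L) * K) := by
      have : L ^ n * K ^ n = 1 := by rw [← mul_pow, mul_comm L, hKL, one_pow]
      rw [mul_pow]
      linear_combination X ^ n * d⁄dX R (X * L) * K * this
    have h4 : coeff 0 (d⁄dX R (X * L) * K) = 1 := by
      rw [Derivation.leibniz, derivative_X, smul_eq_mul, smul_eq_mul]
      have := congrArg constantCoeff hKL
      simp only [map_mul, map_one] at this
      simp [mul_comm, this]
    rw [h3, coeff_X_pow_mul', if_pos le_rfl, Nat.sub_self, h4, coeff_derivative]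
    ring
  · intro k hk hkn
    obtain ⟨j, rfl⟩ : ∃ j, n = k + (j + 1) :=
      ⟨n - k - 1, by have := Finset.mem_range.mp hk; omega⟩
    have h3 : (X * L) ^ k * (d⁄dX R (X * L) * K ^ (k + (j + 1) + 1)) =
        X ^ k * (K ^ (j + 1) - X * d⁄dX R K * K ^ j) := by
      have : L ^ k * K ^ k = 1 := by rw [← mul_pow, mul_comm L, hKL, one_pow]
      rw [mul_pow]
      linear_combination X ^ k * d⁄dX R (X * L) * K ^ (j + 2) * this + X ^ k * K ^ j * hGK
    rw [h3, coeff_X_pow_mul', if_pos (by omega), Nat.add_sub_cancel_left]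
    -- `(j+1) X K' K^j = X (K^(j+1))'`, whose coefficient at `X^(j+1)` is `j+1` times that of
    -- `K^(j+1)`: the two terms cancel.
    have h5 : ((j + 1 : ℕ) : R) * coeff (j + 1) (K ^ (j + 1) - X * d⁄dX R K * K ^ j) = 0 := by
      have h6 : X * d⁄dX R (K ^ (j + 1)) = ((j + 1 : ℕ) : R⟦X⟧) * (X * d⁄dX R K * K ^ j) := by
        rw [derivative_pow, Nat.add_sub_cancel]
        ring
      have h7 := congrArg (coeff (j + 1)) h6
      rw [coeff_X_mul_derivative, ← map_natCast (C (R := R)), coeff_C_mul] at h7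
      rw [map_sub, mul_sub, h7, sub_self]
    have hu : (algebraMap ℚ R ((j + 1 : ℕ) : ℚ)⁻¹) * ((j + 1 : ℕ) : R) = 1 := by
      rw [← map_natCast (algebraMap ℚ R), ← map_mul, inv_mul_cancel₀, map_one]
      exact_mod_cast j.succ_ne_zero
    rw [← one_mul (coeff (j + 1) _), ← hu, mul_assoc, h5, mul_zero, mul_zero]
  · simp

end LogDerivative

/-! ### Cycle indices and their recursion -/

section CycleIndex

/-- The parts of the partitions of `n`, as multisets. -/
def partsFinset (n : ℕ) : Finset (Multiset ℕ) :=
  Finset.univ.image (Nat.Partition.parts (n := n))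

theorem mem_partsFinset {n : ℕ} {s : Multiset ℕ} :
    s ∈ partsFinset n ↔ (∀ k ∈ s, 0 < k) ∧ s.sum = n := by
  constructor
  · intro h
    obtain ⟨μ, -, rfl⟩ := Finset.mem_image.mp h
    exact ⟨fun k hk => μ.parts_pos hk, μ.parts_sum⟩
  · rintro ⟨h1, h2⟩
    exact Finset.mem_image.mpr ⟨⟨s, fun hk => h1 _ hk, h2⟩, Finset.mem_univ _, rfl⟩

/-- The order `z_μ = ∏ₖ k ^ mₖ mₖ!` of the centralizer of a permutation of cycle type `μ`. -/
def zNumber (s : Multiset ℕ) : ℕ := s.prod * ∏ k ∈ s.toFinset, (s.count k).factorial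

theorem zNumber_cons (k : ℕ) (s : Multiset ℕ) :
    zNumber (k ::ₘ s) = k * ((k ::ₘ s).count k) * zNumber s := by
  have h : ∏ j ∈ (k ::ₘ s).toFinset, ((k ::ₘ s).count j).factorial =
      (s.count k + 1) * ∏ j ∈ s.toFinset, (s.count j).factorial := by
    rw [Multiset.toFinset_cons]
    have h1 : ∏ j ∈ s.toFinset, (s.count j).factorial =
        ∏ j ∈ insert k s.toFinset, (s.count j).factorial := by
      refine Finset.prod_subset (Finset.subset_insert _ _) fun j _ hj => ?_
      rw [Multiset.count_eq_zero_of_notMem (by simpa using hj), Nat.factorial_zero]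
    rw [h1, ← Finset.mul_prod_erase _ _ (Finset.mem_insert_self k _),
      ← Finset.mul_prod_erase (insert k s.toFinset) (fun j => (s.count j).factorial)
        (Finset.mem_insert_self k _), Multiset.count_cons_self, Nat.factorial_succ]
    rw [Finset.prod_congr rfl (g := fun j => (s.count j).factorial) fun j hj => by
      rw [Multiset.count_cons_of_ne (Finset.ne_of_mem_erase hj)]]
    ring
  rw [zNumber, h, zNumber, Multiset.prod_cons, Multiset.count_cons_self]
  ring

theorem zNumber_ne_zero {s : Multiset ℕ} (hs : ∀ k ∈ s, 0 < k) : zNumber s ≠ 0 := by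
  refine mul_ne_zero (Multiset.prod_ne_zero fun h => (hs 0 h).ne' rfl)
    (Finset.prod_ne_zero_iff.mpr fun k _ => Nat.factorial_ne_zero _)

/-- The class-size formula for `cycleType` applies once the parts equal to `1` are split off:
`cycleType` omits fixed points, and they contribute only the factor `(s.count 1)!`. -/
theorem card_partition_parts_mul_zNumber {n : ℕ} {s : Multiset ℕ} (hs : s ∈ partsFinset n) :
    (Finset.univ.filter fun w : Equiv.Perm (Fin n) => w.partition.parts = s).card * zNumber s =
      n.factorial := by
  obtain ⟨hpos, hsum⟩ := mem_partsFinset.mp hs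
  set m := s.filter fun k => 2 ≤ k with hm
  have hones : s.filter (fun k => ¬ 2 ≤ k) = Multiset.replicate (s.count 1) 1 := by
    rw [← Multiset.filter_eq']
    refine Multiset.filter_congr fun k hk => ?_
    have := hpos k hk
    omega
  have hsplit : s = m + Multiset.replicate (s.count 1) 1 := by
    rw [hm, ← hones, Multiset.filter_add_not]
  have hcount : n - m.sum = s.count 1 := by
    have h := congrArg Multiset.sum hsplit
    rw [Multiset.sum_add, Multiset.sum_replicate, smul_eq_mul, mul_one, hsum] at h
    omega
  have hset : (Finset.univ.filter fun w : Equiv.Perm (Fin n) => w.partition.parts = s) =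
      Finset.univ.filter fun w : Equiv.Perm (Fin n) => w.cycleType = m := by
    ext w
    simp only [Finset.mem_filter, Finset.mem_univ, true_and]
    constructor
    · intro h
      rw [← Equiv.Perm.filter_parts_partition_eq_cycleType, h]
    · intro h
      rw [Equiv.Perm.parts_partition, ← Equiv.Perm.sum_cycleType, h, Fintype.card_fin, hcount,
        ← hsplit]
  have hle : m.sum ≤ n := by
    have h := congrArg Multiset.sum hsplit
    rw [Multiset.sum_add, hsum] at h
    omega
  have hcard := Equiv.Perm.card_of_cycleType_mul_eq (Fin n) m
  rw [Fintype.card_fin, if_pos ⟨hle, fun a ha => (Multiset.mem_filter.mp ha).2⟩, hcount] at hcard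
  rw [hset, ← hcard]
  congr 1
  have hprod : s.prod = m.prod := by
    conv_lhs => rw [hsplit]
    simp
  have hfac : ∏ k ∈ s.toFinset, (s.count k).factorial =
      (s.count 1).factorial * ∏ k ∈ m.toFinset, (m.count k).factorial := by
    have h1 : ∏ k ∈ s.toFinset, (s.count k).factorial =
        ∏ k ∈ insert 1 s.toFinset, (s.count k).factorial := by
      refine Finset.prod_subset (Finset.subset_insert _ _) fun j _ hj => ?_
      rw [Multiset.count_eq_zero_of_notMem (by simpa using hj), Nat.factorial_zero]
    have h2 : m.toFinset = (insert 1 s.toFinset).erase 1 := by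
      ext k
      simp only [hm, Multiset.mem_toFinset, Multiset.mem_filter, Finset.mem_erase,
        Finset.mem_insert]
      constructor
      · rintro ⟨h, h'⟩
        exact ⟨by omega, Or.inr h⟩
      · rintro ⟨h, h'⟩
        have hk := h'.resolve_left h
        have := hpos k hk
        exact ⟨hk, by omega⟩
    rw [h1, ← Finset.mul_prod_erase _ _ (Finset.mem_insert_self 1 _), h2]
    congr 1
    refine Finset.prod_congr rfl fun k hk => ?_
    rw [← h2, Multiset.mem_toFinset] at hk
    rw [hm, Multiset.count_filter_of_pos (Multiset.mem_filter.mp hk).2]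
  rw [zNumber, hprod, hfac]
  ring

variable {R : Type*} [CommRing R] [Algebra ℚ R]

/-- The cycle index `(1 / n!) ∑_w ∏_c y_{|c|}`, over the cycles `c` of the permutations `w`. -/
def cycleIndex (y : ℕ → R) (n : ℕ) : R :=
  (n.factorial : ℚ)⁻¹ • ∑ w : Equiv.Perm (Fin n), (w.partition.parts.map y).prod

theorem cycleIndex_eq_sum (y : ℕ → R) (n : ℕ) :
    cycleIndex y n = ∑ s ∈ partsFinset n, (zNumber s : ℚ)⁻¹ • (s.map y).prod := by
  have hmaps : ∀ w ∈ (Finset.univ : Finset (Equiv.Perm (Fin n))),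
      w.partition.parts ∈ partsFinset n := fun w _ =>
    mem_partsFinset.mpr ⟨fun k hk => w.partition.parts_pos hk,
      w.partition.parts_sum.trans (Fintype.card_fin n)⟩
  rw [cycleIndex, ← Finset.sum_fiberwise_of_maps_to hmaps, Finset.smul_sum]
  refine Finset.sum_congr rfl fun s hs => ?_
  rw [Finset.sum_congr rfl (g := fun _ => (s.map y).prod) fun w hw => by
    rw [(Finset.mem_filter.mp hw).2], Finset.sum_const, ← Nat.cast_smul_eq_nsmul ℚ, smul_smul]
  congr 1
  have hz : (zNumber s : ℚ) ≠ 0 := by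
    exact_mod_cast zNumber_ne_zero (mem_partsFinset.mp hs).1
  have hn : (n.factorial : ℚ) ≠ 0 := by exact_mod_cast n.factorial_ne_zero
  have := card_partition_parts_mul_zNumber hs
  field_simp
  exact_mod_cast this

theorem cycleIndex_zero (y : ℕ → R) : cycleIndex y 0 = 1 := by
  have h : ∀ w : Equiv.Perm (Fin 0), (w.partition.parts.map y).prod = 1 := fun w => by
    have h0 : w.partition.parts = 0 := by
      refine Multiset.eq_zero_of_forall_notMem fun k hk => ?_
      have h1 := w.partition.le_of_mem_parts hk
      have h2 := w.partition.parts_pos hk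
      rw [Fintype.card_fin] at h1
      omega
    rw [h0, Multiset.map_zero, Multiset.prod_zero]
  simp [cycleIndex, h]

/-- Since `n = ∑ k m_k` over the distinct parts of `s`, and `z_s = k m_k z_{s - k}`, one has `n /
z_s = ∑ 1 / z_{s - k}`. Pairs (partition, one of its distinct parts) then correspond to pairs (part,
remaining partition). -/
theorem mul_cycleIndex (y : ℕ → R) (hy : y 0 = 0) (n : ℕ) :
    n * cycleIndex y n =
      ∑ p ∈ Finset.HasAntidiagonal.antidiagonal n, y p.1 * cycleIndex y p.2 := by
  have hleft : (n : R) * cycleIndex y n =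
      ∑ x ∈ (partsFinset n).sigma fun s => s.toFinset,
        (zNumber (x.1.erase x.2) : ℚ)⁻¹ • (x.1.map y).prod := by
    rw [cycleIndex_eq_sum, Finset.mul_sum, Finset.sum_sigma]
    refine Finset.sum_congr rfl fun s hs => ?_
    obtain ⟨hpos, hsum⟩ := mem_partsFinset.mp hs
    dsimp only
    rw [← Finset.sum_smul, ← nsmul_eq_mul, ← Nat.cast_smul_eq_nsmul ℚ, smul_smul]
    congr 1
    have hn : (n : ℚ) = ∑ k ∈ s.toFinset, (s.count k : ℚ) * k := by
      rw [← hsum, Finset.sum_multiset_count]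
      push_cast
      simp
    rw [hn, Finset.sum_mul]
    refine Finset.sum_congr rfl fun k hk => ?_
    rw [Multiset.mem_toFinset] at hk
    have hz := zNumber_cons k (s.erase k)
    rw [Multiset.cons_erase hk] at hz
    have h1 : (zNumber (s.erase k) : ℚ) ≠ 0 := by
      exact_mod_cast zNumber_ne_zero fun j hj => hpos j (Multiset.mem_of_mem_erase hj)
    have h2 : (k : ℚ) ≠ 0 := by exact_mod_cast (hpos k hk).ne'
    have h3 : (s.count k : ℚ) ≠ 0 := by exact_mod_cast (Multiset.count_pos.mpr hk).ne'
    rw [hz]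
    push_cast
    field_simp
  have hright : ∑ p ∈ Finset.HasAntidiagonal.antidiagonal n, y p.1 * cycleIndex y p.2 =
      ∑ x ∈ ((Finset.HasAntidiagonal.antidiagonal n).filter fun p => p.1 ≠ 0).sigma
        fun p => partsFinset p.2, (zNumber x.2 : ℚ)⁻¹ • ((x.1.1 ::ₘ x.2).map y).prod := by
    rw [Finset.sum_sigma, Finset.sum_filter]
    refine Finset.sum_congr rfl fun p _ => ?_
    split_ifs with h
    · rw [cycleIndex_eq_sum, Finset.mul_sum]
      refine Finset.sum_congr rfl fun s _ => ?_
      rw [Multiset.map_cons, Multiset.prod_cons, mul_smul_comm]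
    · rw [not_not] at h
      rw [h, hy, zero_mul]
  rw [hleft, hright]
  refine Finset.sum_bij' (fun x _ => ⟨(x.2, n - x.2), x.1.erase x.2⟩)
    (fun x _ => ⟨x.1.1 ::ₘ x.2, x.1.1⟩) ?_ ?_ ?_ ?_ ?_
  · rintro ⟨s, k⟩ hx
    simp only [Finset.mem_sigma, Multiset.mem_toFinset, mem_partsFinset, Finset.mem_filter,
      Finset.HasAntidiagonal.mem_antidiagonal] at hx ⊢
    obtain ⟨⟨hpos, hsum⟩, hk⟩ := hx
    have h1 := hpos k hk
    have h2 := Multiset.sum_erase hk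
    refine ⟨⟨by omega, by omega⟩, fun j hj => hpos j (Multiset.mem_of_mem_erase hj), by omega⟩
  · rintro ⟨⟨i, j⟩, s⟩ hx
    simp only [Finset.mem_sigma, Multiset.mem_toFinset, mem_partsFinset, Finset.mem_filter,
      Finset.HasAntidiagonal.mem_antidiagonal] at hx ⊢
    obtain ⟨⟨hij, hi⟩, hpos, hsum⟩ := hx
    refine ⟨⟨fun k hk => ?_, by rw [Multiset.sum_cons]; omega⟩, Multiset.mem_cons_self _ _⟩
    rcases Multiset.mem_cons.mp hk with rfl | hk
    · omega
    · exact hpos k hk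
  · rintro ⟨s, k⟩ hx
    simp only [Finset.mem_sigma, Multiset.mem_toFinset] at hx
    simp [Multiset.cons_erase hx.2]
  · rintro ⟨⟨i, j⟩, s⟩ hx
    simp only [Finset.mem_sigma, Finset.mem_filter,
      Finset.HasAntidiagonal.mem_antidiagonal] at hx
    have : n - i = j := by omega
    simp [this]
  · rintro ⟨s, k⟩ hx
    simp only [Finset.mem_sigma, Multiset.mem_toFinset] at hx
    simp only [Multiset.cons_erase hx.2]

/-- A series with logarithmic derivative `∑ₖ yₖ tᵏ⁻¹` and constant term `1` generates the cycle
indices in `y`. -/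
theorem coeff_eq_cycleIndex {f : PowerSeries R} {y : ℕ → R} (hy : y 0 = 0)
    (h0 : PowerSeries.constantCoeff f = 1)
    (hf : PowerSeries.X * PowerSeries.derivative R f = PowerSeries.mk y * f) (n : ℕ) :
    PowerSeries.coeff n f = cycleIndex y n := by
  refine coeff_eq_of_logDerivative (Q := PowerSeries.mk y)
    (a := fun n => PowerSeries.coeff n f) (b := cycleIndex y) ?_ ?_ (coeff_of_logDerivative hf)
    (fun n => ?_) n
  · rw [← PowerSeries.coeff_zero_eq_constantCoeff_apply, PowerSeries.coeff_mk, hy]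
  · rw [cycleIndex_zero, PowerSeries.coeff_zero_eq_constantCoeff_apply, h0]
  · simp only [PowerSeries.coeff_mk]
    exact mul_cycleIndex y hy n

end CycleIndex

/-! ### The series K and its powers -/

section KSeries
open PowerSeries Filter Topology

/-- `xt/(1+xt) + xt/(1-xt) = 2xt/(1-x²t²)`, which expands into odd powers only. -/
theorem logDerivative_geometric {R : Type*} [CommRing R] (x : R) (u : R⟦X⟧)
    (hu : (1 - C x * X) * u = 1) :
    X * d⁄dX R ((1 + C x * X) * u) =
      mk (fun k => if Odd k then 2 * x ^ k else 0) * ((1 + C x * X) * u) := by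
  have hQ : (1 - C x * X) * (1 + C x * X) * mk (fun k => if Odd k then 2 * x ^ k else 0) =
      2 * (C x * X) := by
    have h : (1 - C x * X) * (1 + C x * X) * mk (fun k => if Odd k then 2 * x ^ k else 0) =
        mk (fun k => if Odd k then 2 * x ^ k else 0) -
          C (x ^ 2) * (mk (fun k => if Odd k then 2 * x ^ k else 0) * X ^ 2) := by
      rw [map_pow]
      ring
    have h2 : (2 : R⟦X⟧) * (C x * X) = C (2 * x) * X := by
      rw [map_mul, map_ofNat, mul_assoc]
    rw [h, h2]
    ext n
    rcases n with _ | _ | n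
    · simp
    · rw [map_sub, coeff_C_mul, coeff_mul_X_pow', if_neg (by omega)]
      simp
    · have hodd : Odd (n + 2) ↔ Odd n := by simp [parity_simps]
      have hX : coeff (n + 2) (X : R⟦X⟧) = 0 := by rw [coeff_X, if_neg (by omega)]
      change coeff (n + 2) _ = coeff (n + 2) _
      rw [map_sub, coeff_C_mul, coeff_mul_X_pow, coeff_mk, coeff_mk, coeff_C_mul, hX,
        if_congr hodd rfl rfl]
      split_ifs <;> ring
  have hd := congrArg (d⁄dX R) hu
  have hD : d⁄dX R (1 - C x * X) = - C x := by
    simp [Derivation.leibniz]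
  have hD' : d⁄dX R (1 + C x * X) = C x := by
    simp [Derivation.leibniz]
  rw [Derivation.leibniz, smul_eq_mul, smul_eq_mul, hD, derivative_one] at hd
  rw [Derivation.leibniz, smul_eq_mul, smul_eq_mul, hD']
  set Q : R⟦X⟧ := mk (fun k => if Odd k then 2 * x ^ k else 0)
  set c : R⟦X⟧ := C x
  set v := d⁄dX R u
  -- `u = 1/(1 - cX)`, so its derivative is `c u²`.
  have hv : v = c * u ^ 2 := by linear_combination u * hd - v * hu
  have hq : (1 + c * X) * Q = 2 * c * X * u := by
    linear_combination u * hQ - (1 + c * X) * Q * hu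
  linear_combination X * (1 + c * X) * hv - u * hq - X * c * u * hu

theorem kFactor_inv (i : ℕ) : (1 - C (MvPowerSeries.X i) * X) *
    invOfUnit (1 - C (MvPowerSeries.X i : MvPowerSeries ℕ ℚ) * X) 1 = 1 :=
  mul_invOfUnit _ _ (by simp)

theorem constantCoeff_kFactor (i : ℕ) : constantCoeff (kFactor i) = 1 := by
  simp [kFactor]

theorem logDerivative_kFactor (i : ℕ) : X * d⁄dX _ (kFactor i) =
    mk (fun k => if Odd k then 2 * MvPowerSeries.X i ^ k else 0) * kFactor i :=
  logDerivative_geometric _ _ (kFactor_inv i)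

/-- The shiftification of the power sum `p_k`, as a power series in `x`. -/
def oddPowerSum (k : ℕ) : MvPowerSeries ℕ ℚ := if Odd k then 2 * (powerSum k).1 else 0

theorem tendsto_sum_X_pow (k : ℕ) (hk : 0 < k) :
    Tendsto (fun s : Finset ℕ => ∑ i ∈ s, (MvPowerSeries.X i : MvPowerSeries ℕ ℚ) ^ k) atTop
      (𝓝 (powerSum k).1) := by
  classical
  rw [MvPowerSeries.WithPiTopology.tendsto_iff_coeff_tendsto]
  intro m
  have hval : MvPowerSeries.coeff m (powerSum k).1 =
      if ∃ i : ℕ, m = Finsupp.single i k then 1 else 0 := by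
    change (if _ then (1 : ℚ) else 0) = _
    congr
  simp only [map_sum, MvPowerSeries.coeff_X_pow, hval]
  split_ifs with h
  · obtain ⟨i, rfl⟩ := h
    refine tendsto_const_nhds.congr' ?_
    filter_upwards [eventually_ge_atTop {i}] with s hs
    rw [Finset.sum_eq_single i]
    · simp
    · intro j _ hj
      rw [if_neg]
      intro hc
      exact hj (Finsupp.single_left_injective hk.ne' hc).symm
    · intro hi
      exact absurd (hs (Finset.mem_singleton_self i)) hi
  · refine tendsto_const_nhds.congr fun s => (Finset.sum_eq_zero fun i _ => if_neg ?_).symm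
    exact fun hc => h ⟨i, hc⟩

theorem tendsto_oddPowerSum (k : ℕ) :
    Tendsto (fun s : Finset ℕ => ∑ i ∈ s,
        if Odd k then 2 * (MvPowerSeries.X i : MvPowerSeries ℕ ℚ) ^ k else 0) atTop
      (𝓝 (oddPowerSum k)) := by
  rw [oddPowerSum]
  split_ifs with h
  · simp only [← Finset.mul_sum]
    exact (tendsto_sum_X_pow k h.pos).const_mul 2
  · simp

/-- A cycle index is a polynomial in finitely many `y k`, hence continuous. -/
theorem tendsto_cycleIndex {ι R : Type*} [CommRing R] [Algebra ℚ R] [TopologicalSpace R]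
    [IsTopologicalRing R] {l : Filter ι} {y : ι → ℕ → R} {z : ℕ → R}
    (h : ∀ k, Tendsto (fun i => y i k) l (𝓝 (z k))) (n : ℕ) :
    Tendsto (fun i => cycleIndex (y i) n) l (𝓝 (cycleIndex z n)) := by
  simp only [cycleIndex, Algebra.smul_def]
  refine Tendsto.const_mul _ (tendsto_finsetSum _ fun w _ => ?_)
  exact tendsto_multiset_prod _ fun k _ => h k

theorem coeff_prod_kFactor (s : Finset ℕ) (n : ℕ) :
    coeff n (∏ i ∈ s, kFactor i) = cycleIndex (fun k => ∑ i ∈ s,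
        if Odd k then 2 * (MvPowerSeries.X i : MvPowerSeries ℕ ℚ) ^ k else 0) n := by
  refine coeff_eq_cycleIndex (by simp) ?_ ?_ n
  · rw [map_prod]
    exact Finset.prod_eq_one fun i _ => constantCoeff_kFactor i
  · rw [logDerivative_prod s logDerivative_kFactor]
    congr 1
    ext1 k
    simp only [map_sum, coeff_mk]

/-- The coefficients of a finite product are cycle indices in truncated power sums, so convergence
of the product reduces to convergence of the power sums. -/
theorem hasProd_kFactor : HasProd kFactor (mk (cycleIndex oddPowerSum)) := by
  change Tendsto _ _ _
  rw [SummationFilter.unconditional_filter, PowerSeries.WithPiTopology.tendsto_iff_coeff_tendsto]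
  intro n
  simp only [coeff_prod_kFactor, coeff_mk]
  exact tendsto_cycleIndex tendsto_oddPowerSum n

theorem kSeries_eq : kSeries = mk (cycleIndex oddPowerSum) := hasProd_kFactor.tprod_eq

theorem oddPowerSum_zero : oddPowerSum 0 = 0 := by simp [oddPowerSum]

theorem constantCoeff_kSeries : constantCoeff kSeries = 1 := by
  rw [kSeries_eq, ← coeff_zero_eq_constantCoeff_apply, coeff_mk, cycleIndex_zero]

/-- Read off from the cycle index recursion, which avoids differentiating an infinite product. -/
theorem logDerivative_kSeries : X * d⁄dX _ kSeries = mk oddPowerSum * kSeries := by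
  ext1 n
  rw [kSeries_eq, coeff_X_mul_derivative, coeff_mul]
  simp only [coeff_mk]
  exact mul_cycleIndex _ oddPowerSum_zero n

theorem coeff_kSeries_pow (m n : ℕ) :
    coeff n (kSeries ^ m) = cycleIndex (fun k => m * oddPowerSum k) n := by
  refine coeff_eq_cycleIndex (by simp [oddPowerSum_zero]) ?_ ?_ n
  · rw [map_pow, constantCoeff_kSeries, one_pow]
  · rw [logDerivative_pow logDerivative_kSeries]
    congr 1
    ext1 k
    rw [← map_natCast (C (R := MvPowerSeries ℕ ℚ)), coeff_C_mul, coeff_mk, coeff_mk]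

/-- `oddPowerSum` vanishes at even indices, so `t ↦ -t` negates the logarithmic derivative and the
product has logarithmic derivative `0`. -/
theorem kSeries_mul_rescale : kSeries * rescale (-1) kSeries = 1 := by
  refine eq_of_logDerivative (Q := 0) (map_zero _) ?_ ?_ (by simp)
  · rw [map_mul, constantCoeff_kSeries, one_mul, map_one,
      ← coeff_zero_eq_constantCoeff_apply, coeff_rescale, coeff_zero_eq_constantCoeff_apply,
      constantCoeff_kSeries, pow_zero, one_mul]
  · rw [logDerivative_mul logDerivative_kSeries
      (logDerivative_rescale_neg_one logDerivative_kSeries)]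
    congr 1
    ext1 k
    rw [map_add, coeff_rescale, coeff_mk, map_zero, oddPowerSum]
    split_ifs with h
    · rw [h.neg_one_pow]; ring
    · simp

end KSeries

/-! ### Counting functions constant on cycles -/

section Cycles
open Equiv.Perm

variable {α : Type*} [Fintype α] [DecidableEq α]

/-- The cycle through a point, with fixed points kept apart. -/
def cycleLabel (w : Equiv.Perm α) (x : α) : Equiv.Perm α ⊕ α :=
  if w x = x then Sum.inr x else Sum.inl (w.cycleOf x)

theorem cycleLabel_eq_iff (w : Equiv.Perm α) (x y : α) :
    cycleLabel w x = cycleLabel w y ↔ w.SameCycle x y := by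
  constructor
  · intro h
    unfold cycleLabel at h
    split_ifs at h with hx hy hy
    · rw [Sum.inr.inj h]
    · exact (sameCycle_iff_cycleOf_eq_of_mem_support (mem_support.mpr hx)
        (mem_support.mpr hy)).mpr (Sum.inl.inj h)
  · intro h
    unfold cycleLabel
    by_cases hx : w x = x
    · have hxy : x = y := by
        obtain ⟨i, rfl⟩ := h
        exact (zpow_apply_eq_self_of_apply_eq_self hx i).symm
      rw [hxy]
    · have hy : ¬ w y = y := fun hy => hx (h.apply_eq_self_iff.mpr hy)
      rw [if_neg hx, if_neg hy, h.cycleOf_eq]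

/-- The labels that occur are the nontrivial cycle factors together with the fixed points, and
`partition` has one part for each of these. -/
theorem card_quotient_sameCycle (w : Equiv.Perm α) :
    Nat.card (Quotient (SameCycle.setoid w)) = w.partition.parts.card := by
  have hker : SameCycle.setoid w = Setoid.ker (cycleLabel w) := by
    ext x y
    exact (cycleLabel_eq_iff w x y).symm
  have hrange : Set.range (cycleLabel w) = ((w.cycleFactorsFinset.disjSum
      (Finset.univ.filter fun x => w x = x) : Finset (Equiv.Perm α ⊕ α)) : Set _) := by
    ext z
    rw [Finset.mem_coe]
    constructor
    · rintro ⟨x, rfl⟩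
      unfold cycleLabel
      split_ifs with hx
      · simpa using hx
      · simpa [cycleOf_mem_cycleFactorsFinset_iff] using hx
    · rcases z with c | x
      · intro hc
        rw [Finset.inl_mem_disjSum] at hc
        obtain ⟨x, hx⟩ := (mem_cycleFactorsFinset_iff.mp hc).1.nonempty_support
        refine ⟨x, ?_⟩
        rw [cycleLabel, if_neg (mem_support.mp (mem_cycleFactorsFinset_support_le hc hx)),
          cycle_is_cycleOf hx hc]
      · intro hx
        rw [Finset.inr_mem_disjSum] at hx
        exact ⟨x, by rw [cycleLabel, if_pos (Finset.mem_filter.mp hx).2]⟩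
  rw [hker, Nat.card_congr (Setoid.quotientKerEquivRange _), hrange, Nat.card_coe_set_eq,
    Set.ncard_coe_finset, Finset.card_disjSum, parts_partition, Multiset.card_add,
    Multiset.card_replicate, cycleType_def, Multiset.card_map]
  congr 1
  have h := Finset.card_compl w.support
  rw [← h]
  congr 1
  ext x
  simp

/-- A permutation `w` fixes `m ^ c` functions to an `m`-element set, where `c` is its number of
cycles. -/
theorem card_invariant_functions (w : Equiv.Perm α) (β : Type*) :
    Nat.card {f : α → β // ∀ x, f (w x) = f x} = Nat.card β ^ w.partition.parts.card := by
  have h : ∀ f : α → β, (∀ x, f (w x) = f x) ↔ SameCycle.setoid w ≤ Setoid.ker f := by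
    intro f
    constructor
    · intro hf x y hxy
      obtain ⟨i, rfl⟩ := SameCycle.exists_nat_pow_eq hxy
      clear hxy
      induction i with
      | zero => rfl
      | succ i ih =>
        rw [pow_succ', mul_apply]
        exact ih.trans (hf _).symm
    · intro hf x
      exact (hf (show w.SameCycle x (w x) from sameCycle_apply_right.mpr SameCycle.rfl)).symm
  rw [Nat.card_congr ((Equiv.subtypeEquivRight h).trans (Setoid.liftEquiv _)), Nat.card_fun,
    card_quotient_sameCycle]

end Cycles

/-! ### Pollak's circle argument -/

section Pollak

/-- The counting form makes no reference to sorting, so it can be read on arcs of a circle. -/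
theorem isParkingFunction_iff {n : ℕ} (a : Fin n → ℕ) : IsParkingFunction a ↔
    (∀ i, 1 ≤ a i) ∧ ∀ j ≤ n, j ≤ (Finset.univ.filter fun i => a i ≤ j).card := by
  refine and_congr_right fun _ => ?_
  have hmono := Tuple.monotone_sort a
  have hcard : ∀ j, (Finset.univ.filter fun i => a i ≤ j).card =
      (Finset.univ.filter fun i => a (Tuple.sort a i) ≤ j).card := fun j => by
    rw [← Finset.card_map (s := Finset.univ.filter fun i => a (Tuple.sort a i) ≤ j)
      (Tuple.sort a).toEmbedding]
    congr 1
    ext i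
    simp
  simp only [hcard]
  constructor
  · intro h j hj
    calc j = (Finset.univ.filter fun i : Fin n => (i : ℕ) < j).card := by
          rw [Fin.card_filter_val_lt, min_eq_right hj]
      _ ≤ _ := Finset.card_le_card fun i hi => by
          rw [Finset.mem_filter] at hi ⊢
          exact ⟨hi.1, (h i).trans hi.2⟩
  · intro h i
    by_contra hi
    have h1 := h (i + 1) i.2
    -- If the sorted value at position `i` (from `0`) exceeds `i + 1`, only the `i` earlier
    -- positions can hold values at most `i + 1`.
    have h2 : (Finset.univ.filter fun k => a (Tuple.sort a k) ≤ i + 1).card ≤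
        (Finset.univ.filter fun k : Fin n => (k : ℕ) < i).card :=
      Finset.card_le_card fun k hk => by
        rw [Finset.mem_filter] at hk ⊢
        refine ⟨hk.1, ?_⟩
        by_contra hik
        have := hmono (show i ≤ k from not_lt.mp hik)
        simp only [Function.comp_apply] at this
        omega
    rw [Fin.card_filter_val_lt] at h2
    have := i.2
    omega

variable {n : ℕ}

/-- The number of values of `f` in the cyclic interval of length `j` that starts at `x`. -/
def arcCount (f : Fin n → ZMod (n + 1)) (x : ZMod (n + 1)) (j : ℕ) : ℕ :=
  (Finset.univ.filter fun i => (f i - x).val < j).card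

theorem zmod_val_lt_add_iff (z : ZMod (n + 1)) {j k : ℕ} (hjk : j + k ≤ n + 1) :
    (z.val < j + k ↔ z.val < j ∨ (z - j).val < k) ∧ ¬ (z.val < j ∧ (z - j).val < k) := by
  have hz := ZMod.val_lt z
  have hcast : ((z.val : ℕ) : ZMod (n + 1)) = z := ZMod.natCast_zmod_val z
  rcases le_or_gt j z.val with h | h
  · have : (z - j).val = z.val - j := by
      conv_lhs => rw [← hcast, ← Nat.cast_sub h]
      exact ZMod.val_natCast_of_lt (by omega)
    omega
  · have : (z - j).val = z.val + (n + 1) - j := by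
      have h1 : z - j = ((z.val + (n + 1) - j : ℕ) : ZMod (n + 1)) := by
        rw [Nat.cast_sub (by omega), Nat.cast_add, hcast, ZMod.natCast_self, add_zero]
      rw [h1]
      exact ZMod.val_natCast_of_lt (by omega)
    omega

theorem arcCount_add (f : Fin n → ZMod (n + 1)) (x : ZMod (n + 1)) {j k : ℕ}
    (hjk : j + k ≤ n + 1) : arcCount f x (j + k) = arcCount f x j + arcCount f (x + j) k := by
  unfold arcCount
  rw [← Finset.card_union_of_disjoint]
  · congr 1
    ext i
    simp only [Finset.mem_filter, Finset.mem_univ, true_and, Finset.mem_union]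
    rw [(zmod_val_lt_add_iff (f i - x) hjk).1, sub_sub]
  · rw [Finset.disjoint_filter]
    intro i _ h1 h2
    rw [← sub_sub] at h2
    exact (zmod_val_lt_add_iff (f i - x) hjk).2 ⟨h1, h2⟩

theorem arcCount_full (f : Fin n → ZMod (n + 1)) (x : ZMod (n + 1)) :
    arcCount f x (n + 1) = n := by
  rw [arcCount, Finset.filter_true_of_mem fun i _ => ZMod.val_lt _, Finset.card_univ,
    Fintype.card_fin]

/-- Two distinct such points cut the circle into two arcs, each holding at least its length in
values: `n + 1` values in all, but there are only `n`. -/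
theorem eq_of_le_arcCount (f : Fin n → ZMod (n + 1)) {x y : ZMod (n + 1)}
    (hx : ∀ j ≤ n, j ≤ arcCount f x j) (hy : ∀ j ≤ n, j ≤ arcCount f y j) : x = y := by
  by_contra hne
  have hpos : (y - x).val ≠ 0 := by
    rw [Ne, ZMod.val_eq_zero, sub_eq_zero]
    exact fun h => hne h.symm
  have hlt := ZMod.val_lt (y - x)
  obtain ⟨k, hk⟩ : ∃ k, (y - x).val + k = n + 1 := ⟨n + 1 - (y - x).val, by omega⟩
  have h := arcCount_add f x hk.le
  rw [hk, arcCount_full, ZMod.natCast_zmod_val, add_sub_cancel] at h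
  have h1 := hx (y - x).val (by omega)
  have h2 := hy k (by omega)
  omega

/-- A cycle lemma: start where the excess `arcCount f 0 j - j` is first minimal. -/
theorem exists_le_arcCount (f : Fin n → ZMod (n + 1)) :
    ∃ x : ZMod (n + 1), ∀ j ≤ n, j ≤ arcCount f x j := by
  -- As `j ≤ n`, the weight `n + 1` makes this order lexicographic: least excess, then least `j`.
  obtain ⟨c, hc, hmin⟩ := Finset.exists_min_image (Finset.range (n + 1))
    (fun j => ((n : ℤ) + 1) * ((arcCount f 0 j : ℤ) - j) + j) ⟨0, by simp⟩
  rw [Finset.mem_range] at hc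
  have hle : ∀ j ≤ n, (arcCount f 0 c : ℤ) - c ≤ (arcCount f 0 j : ℤ) - j := fun j hj => by
    have := hmin j (Finset.mem_range.mpr (by omega))
    by_contra hlt
    have hlt' : (arcCount f 0 j : ℤ) - j + 1 ≤ (arcCount f 0 c : ℤ) - c := by omega
    have := mul_le_mul_of_nonneg_left hlt' (show (0 : ℤ) ≤ (n : ℤ) + 1 by omega)
    rw [mul_add, mul_one] at this
    omega
  have hlt : ∀ j < c, (arcCount f 0 c : ℤ) - c < (arcCount f 0 j : ℤ) - j := fun j hj => by
    have := hmin j (Finset.mem_range.mpr (by omega))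
    by_contra hlt
    have := mul_le_mul_of_nonneg_left (not_lt.mp hlt) (show (0 : ℤ) ≤ (n : ℤ) + 1 by omega)
    omega
  refine ⟨c, fun j hj => ?_⟩
  -- If the arc passes `0`, the full turn loses one (`n` values over `n + 1` places); the strict
  -- inequality `hlt` makes up for it.
  rcases Nat.lt_or_ge n (c + j) with h | h
  · obtain ⟨k, hk⟩ : ∃ k, c + j = (n + 1) + k := ⟨c + j - (n + 1), by omega⟩
    obtain ⟨d, hd⟩ : ∃ d, c + d = n + 1 := ⟨n + 1 - c, by omega⟩
    have h1 := arcCount_add f 0 hd.le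
    rw [hd, arcCount_full, zero_add] at h1
    have hj' : j = d + k := by omega
    have h2 := arcCount_add f c (show d + k ≤ n + 1 by omega)
    rw [← hj', ← Nat.cast_add, hd, ZMod.natCast_self] at h2
    have := hlt k (by omega)
    omega
  · have h1 := arcCount_add f 0 (show c + j ≤ n + 1 by omega)
    rw [zero_add] at h1
    have := hle (c + j) h
    omega

theorem ParkingFunction.le {n : ℕ} (a : ParkingFunction n) (i : Fin n) : a.1 i ≤ n := by
  have h := ((isParkingFunction_iff a.1).mp a.2).2 n le_rfl
  have h2 : (Finset.univ.filter fun i => a.1 i ≤ n) = Finset.univ := by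
    refine Finset.eq_univ_of_card _ (le_antisymm (Finset.card_le_univ _) ?_)
    rwa [Fintype.card_fin]
  have hi := Finset.mem_univ i
  rw [← h2] at hi
  exact (Finset.mem_filter.mp hi).2

/-- Pollak's circular shift of a parking function. -/
def circularShift (p : ParkingFunction n × ZMod (n + 1)) (i : Fin n) : ZMod (n + 1) :=
  ((p.1.1 i - 1 : ℕ) : ZMod (n + 1)) + p.2

theorem val_circularShift_sub (p : ParkingFunction n × ZMod (n + 1)) (i : Fin n) :
    (circularShift p i - p.2).val = p.1.1 i - 1 := by
  rw [circularShift, add_sub_cancel_right]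
  have := p.1.le i
  exact ZMod.val_natCast_of_lt (by omega)

theorem le_arcCount_circularShift (p : ParkingFunction n × ZMod (n + 1)) :
    ∀ j ≤ n, j ≤ arcCount (circularShift p) p.2 j := by
  intro j hj
  refine (((isParkingFunction_iff p.1.1).mp p.1.2).2 j hj).trans (le_of_eq ?_)
  unfold arcCount
  congr 1
  ext i
  simp only [Finset.mem_filter, Finset.mem_univ, true_and, val_circularShift_sub]
  have := p.1.2.1 i
  omega

/-- The rotation is recovered as the unique starting point from which every arc of length `j ≤ n`
holds at least `j` values. -/
theorem circularShift_bijective : Function.Bijective (circularShift (n := n)) := by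
  constructor
  · intro p q h
    have h2 : p.2 = q.2 := eq_of_le_arcCount (circularShift p) (le_arcCount_circularShift p)
      (by rw [h]; exact le_arcCount_circularShift q)
    refine Prod.ext (Subtype.ext (funext fun i => ?_)) h2
    have hp := val_circularShift_sub p i
    rw [h, h2, val_circularShift_sub q i] at hp
    have := p.1.2.1 i
    have := q.1.2.1 i
    omega
  · intro f
    obtain ⟨x, hx⟩ := exists_le_arcCount f
    refine ⟨(⟨fun i => (f i - x).val + 1, (isParkingFunction_iff _).mpr
      ⟨fun i => by omega, hx⟩⟩, x), funext fun i => ?_⟩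
    simp [circularShift]

theorem smul_parkingFunction_apply (w : Equiv.Perm (Fin n)) (a : ParkingFunction n) (i : Fin n) :
    (w • a).1 i = a.1 (w⁻¹ i) := rfl

/-- Rotation acts on values and `w` on positions, so the two commute. -/
theorem circularShift_invariant_iff (w : Equiv.Perm (Fin n))
    (p : ParkingFunction n × ZMod (n + 1)) :
    w • p.1 = p.1 ↔ ∀ i, circularShift p (w i) = circularShift p i := by
  have h1 : w • p.1 = p.1 ↔ ∀ i, p.1.1 (w i) = p.1.1 i := by
    rw [eq_comm]
    constructor
    · intro h i
      have := congrArg (fun a : ParkingFunction n => a.1 (w i)) h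
      simpa [smul_parkingFunction_apply] using this
    · intro h
      refine Subtype.ext (funext fun i => ?_)
      have := h (w⁻¹ i)
      rw [smul_parkingFunction_apply, ← this]
      simp
  rw [h1]
  refine forall_congr' fun i => ⟨fun h => ?_, fun h => ?_⟩
  · rw [circularShift, h, circularShift]
  · have := congrArg (fun z => (z - p.2).val) h
    simp only [val_circularShift_sub] at this
    have := p.1.2.1 i
    have := p.1.2.1 (w i)
    omega

/-- Pollak's bijection restricts to the `w`-invariant elements on both sides. -/
theorem card_fixed_parkingFunctions (w : Equiv.Perm (Fin n)) :
    Nat.card {a : ParkingFunction n // w • a = a} * (n + 1) =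
      (n + 1) ^ w.partition.parts.card := by
  have h := card_invariant_functions w (ZMod (n + 1))
  rw [Nat.card_zmod] at h
  have hprod : Nat.card {a : ParkingFunction n // w • a = a} * (n + 1) =
      Nat.card ({a : ParkingFunction n // w • a = a} × ZMod (n + 1)) := by
    rw [Nat.card_prod, Nat.card_zmod]
  rw [← h, hprod]
  refine Nat.card_congr (Equiv.trans ?_
    ((Equiv.ofBijective _ circularShift_bijective).subtypeEquiv (circularShift_invariant_iff w)))
  exact
    { toFun := fun p => ⟨(p.1.1, p.2), p.1.2⟩
      invFun := fun p => (⟨p.1.1, p.2⟩, p.1.2)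
      left_inv := fun _ => rfl
      right_inv := fun _ => rfl }

end Pollak

/-! ### Characters and the Frobenius characteristic -/

/-- In the basis of points, `g` is a permutation matrix with diagonal entry `1` exactly at fixed
points. -/
theorem character_ofMulAction {G X : Type*} [Group G] [MulAction G X] [Finite X] (g : G) :
    (Representation.ofMulAction ℚ G X).character g = Nat.card {x : X // g • x = x} := by
  classical
  have := Fintype.ofFinite X
  let b : Module.Basis X ℚ (MonoidAlgebra ℚ X) := MonoidAlgebra.basis X ℚ
  change LinearMap.trace ℚ _ _ = _
  rw [LinearMap.trace_eq_matrix_trace ℚ b, Matrix.trace, Nat.card_eq_fintype_card,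
    Fintype.card_subtype, Finset.card_filter, Nat.cast_sum]
  refine Finset.sum_congr rfl fun x _ => ?_
  rw [Matrix.diag_apply, LinearMap.toMatrix_apply]
  have hb : b x = MonoidAlgebra.single x 1 := rfl
  rw [hb, Representation.ofMulAction_single]
  have hrepr : b.repr (MonoidAlgebra.single (g • x) 1) = Finsupp.single (g • x) 1 := rfl
  rw [hrepr, Finsupp.single_apply, Nat.cast_ite, Nat.cast_one, Nat.cast_zero]

theorem coe_shiftification_powerSumPart {n : ℕ} (μ : n.Partition) :
    (shiftification (powerSumPart μ) : MvPowerSeries ℕ ℚ) = (μ.parts.map oddPowerSum).prod := by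
  change SymFun.val (shiftification (powerSumPart μ)) = _
  rw [powerSumPart, map_multiset_prod, map_multiset_prod, Multiset.map_map, Multiset.map_map]
  congr 1
  refine Multiset.map_congr rfl fun k hk => ?_
  simp only [Function.comp_apply, shiftification_powerSum k (μ.parts_pos hk), oddPowerSum]
  split_ifs
  · rw [map_mul, map_ofNat]
    rfl
  · exact map_zero _

theorem mul_shiftedParkingSymFun (n : ℕ) :
    (n + 1 : MvPowerSeries ℕ ℚ) * (shiftedParkingSymFun n : MvPowerSeries ℕ ℚ) =
      PowerSeries.coeff n (kSeries ^ (n + 1)) := by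
  have hsh : (shiftedParkingSymFun n : MvPowerSeries ℕ ℚ) = (n.factorial : ℚ)⁻¹ •
      ∑ w : Equiv.Perm (Fin n), (Nat.card {a : ParkingFunction n // w • a = a} : ℚ) •
        (w.partition.parts.map oddPowerSum).prod := by
    change SymFun.val (shiftification (parkingSymFun n)) = _
    rw [parkingSymFun, frobeniusCharacteristic, map_smul, map_smul, map_sum, map_sum]
    congr 1
    refine Finset.sum_congr rfl fun w _ => ?_
    rw [map_smul, map_smul, character_ofMulAction]
    congr 1
    exact coe_shiftification_powerSumPart _
  rw [coeff_kSeries_pow, cycleIndex, hsh, mul_smul_comm, Finset.mul_sum]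
  congr 1
  refine Finset.sum_congr rfl fun w _ => ?_
  -- Pulling `n + 1` out of each cycle's factor gives `(n + 1)^c(w)`, the fixed-point count times `n
  -- + 1`.
  rw [Multiset.prod_map_mul, Multiset.map_const', Multiset.prod_replicate, Algebra.smul_def,
    map_natCast, ← mul_assoc]
  congr 1
  have := card_fixed_parkingFunctions w
  rw [mul_comm]
  exact_mod_cast congrArg (Nat.cast (R := MvPowerSeries ℕ ℚ)) this

end ShiftedParking
end

/-! ### The generating function as a compositional inverse -/

theorem mainTheorem5 :
    Multipliable ShiftedParking.kFactor ∧
    ∃ h : IsUnit (PowerSeries.coeff 1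
        (PowerSeries.X * PowerSeries.rescale (-1) ShiftedParking.kSeries)),
      PowerSeries.X * PowerSeries.mk (fun n : ℕ =>
        (ShiftedParking.shiftedParkingSymFun n : MvPowerSeries ℕ ℚ)) =
      PowerSeries.substInvOfIsUnit
        (PowerSeries.X * PowerSeries.rescale (-1) ShiftedParking.kSeries) h := by
  have hunit : IsUnit (PowerSeries.coeff 1
      (PowerSeries.X * PowerSeries.rescale (-1) ShiftedParking.kSeries)) := by
    rw [show (1 : ℕ) = 0 + 1 from rfl, PowerSeries.coeff_succ_X_mul, PowerSeries.coeff_rescale,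
      PowerSeries.coeff_zero_eq_constantCoeff_apply, ShiftedParking.constantCoeff_kSeries]
    simp
  refine ⟨ShiftedParking.hasProd_kFactor.multipliable, hunit, ?_⟩
  have hinv := PowerSeries.subst_substInvOfIsUnit_left
    (PowerSeries.X * PowerSeries.rescale (-1) ShiftedParking.kSeries) (by simp) hunit
  ext1 n
  rcases n with _ | n
  · rw [PowerSeries.coeff_zero_eq_constantCoeff_apply,
      PowerSeries.coeff_zero_eq_constantCoeff_apply,
      PowerSeries.constantCoeff_substInvOfIsUnit, map_mul, PowerSeries.constantCoeff_X, zero_mul]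
  · rw [PowerSeries.coeff_succ_X_mul, PowerSeries.coeff_mk]
    have h1 := ShiftedParking.mul_shiftedParkingSymFun n
    -- `K(x,-t)` is the inverse of `K`, so `hinv` is the hypothesis of Lagrange inversion with `L =
    -- K(x,-t)`.
    rw [← ShiftedParking.lagrange_inversion ShiftedParking.kSeries_mul_rescale hinv n] at h1
    refine IsUnit.mul_left_cancel ?_ h1
    have h2 : ((n : MvPowerSeries ℕ ℚ) + 1) =
        algebraMap ℚ (MvPowerSeries ℕ ℚ) ((n : ℚ) + 1) := by simp
    rw [h2]
    exact (IsUnit.mk0 _ (by positivity)).map _
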